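/- Let $\rho,\sigma$ be density matrices on a finite-dimensional complex Hilbert space (positive semidefinite, trace one) with the same spectrum, i.e. the same eigenvalues with the same multiplicities. Define the quantum charging distance $D(\rho,\sigma)$ as the infimum of all $T\ge 0$ for which there is a (possibly time-dependent, measurable) Hermitian $V_t$, $t\in[0,T]$, with operator norm $\|V_t\|=1$ for all $t$, such that $\sigma=U\rho U^\dagger$, where $U=\mathrm{Texp}\left(-i\int_0^T V_t\,dt\right)$, that is, $U=U_T$ for the solution of $U_t=I-i\int_0^t V_sU_s\,ds$ on $[0,T]$. Let $F(\rho,\sigma)=\mathrm{tr}\sqrt{\sqrt{\rho}\,\sigma\sqrt{\rho}}$ be Uhlmann's fidelity and $\theta_B(\rho,\sigma)=\arccos F(\rho,\sigma)$ the Bures angle. Then $$\theta_B(\rho,\sigma)\le D(\rho,\sigma).$$ -/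

import Mathlib

namespace QuantumCharging

section States

open scoped ComplexOrder

/-- A density matrix: a positive semidefinite complex matrix of trace one. -/
structure IsDensityMatrix {n : Type*} [Fintype n] (ρ : Matrix n n ℂ) : Prop where
  posSemidef : ρ.PosSemidef
  trace_eq_one : ρ.trace = 1

/-- Two matrices have the same spectrum: the same eigenvalues with the same
(algebraic) multiplicities. -/
def SameSpectrum {n : Type*} [Fintype n] [DecidableEq n] (ρ σ : Matrix n n ℂ) : Prop :=
  ρ.charpoly.roots = σ.charpoly.roots

end States

section Fidelity

open scoped MatrixOrder

/-- Uhlmann's fidelity `tr √(√ρ σ √ρ)`, with positive semidefinite square roots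
(the trace of a positive semidefinite matrix is real). -/
noncomputable def fidelity {n : Type*} [Fintype n] [DecidableEq n] (ρ σ : Matrix n n ℂ) : ℝ :=
  (CFC.sqrt (CFC.sqrt ρ * σ * CFC.sqrt ρ)).trace.re

/-- The Bures angle `arccos F(ρ, σ)`. -/
noncomputable def buresAngle {n : Type*} [Fintype n] [DecidableEq n] (ρ σ : Matrix n n ℂ) : ℝ :=
  Real.arccos (fidelity ρ σ)

end Fidelity

section Charging

open MeasureTheory
open scoped Matrix.Norms.L2Operator

/-- A charging Hamiltonian on `[0, T]`: a measurable, time-dependent Hermitian matrix whose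
operator norm (the `ℓ²` operator norm) is one at all times. -/
structure IsChargingHamiltonian {n : Type*} [Fintype n] [DecidableEq n] (T : ℝ)
    (V : ℝ → Matrix n n ℂ) : Prop where
  aestronglyMeasurable : AEStronglyMeasurable V (volume.restrict (Set.Icc 0 T))
  isHermitian : ∀ t ∈ Set.Icc 0 T, (V t).IsHermitian
  norm_eq_one : ∀ t ∈ Set.Icc 0 T, ‖V t‖ = 1

/-- `U t = Texp (-i ∫₀ᵗ V s ds)` for all `t ∈ [0, T]`: the time-ordered exponential is the
continuous solution of the Schrödinger equation `U' = -i V U`, `U 0 = 1`, in integral form. -/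
structure IsPropagator {n : Type*} [Fintype n] [DecidableEq n] (T : ℝ)
    (V U : ℝ → Matrix n n ℂ) : Prop where
  continuousOn : ContinuousOn U (Set.Icc 0 T)
  eq_integral : ∀ t ∈ Set.Icc 0 T, U t = 1 - Complex.I • ∫ s in (0 : ℝ)..t, V s * U s

/-- The durations `T ≥ 0` in which some charging Hamiltonian drives `ρ` to `σ`. -/
def chargingTimes {n : Type*} [Fintype n] [DecidableEq n] (ρ σ : Matrix n n ℂ) : Set ℝ :=
  {T | 0 ≤ T ∧ ∃ V U : ℝ → Matrix n n ℂ, IsChargingHamiltonian T V ∧ IsPropagator T V U ∧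
    σ = U T * ρ * (U T).conjTranspose}

/-- The quantum charging distance: the minimal duration in which some charging Hamiltonian
drives `ρ` to `σ`. -/
noncomputable def chargingDistance {n : Type*} [Fintype n] [DecidableEq n]
    (ρ σ : Matrix n n ℂ) : ℝ :=
  sInf (chargingTimes ρ σ)

end Charging

end QuantumCharging

/-!
A propagator is Lipschitz in time, hence so is `U† U`, whose derivative
`(-i V U)† U + U† (-i V U) = i U† (V - V) U` vanishes almost everywhere, and `U` stays unitary. For
a unit vector `v`, the curve `t ↦ U t v` therefore runs on the unit sphere with speed at most
`‖V‖ = 1` and sweeps an angle of at most `T`, so that `Re ⟨v, U v⟩ ≥ cos T` whenever `T ≤ π`.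
Averaging over the eigenvectors of `ρ`, weighted by its eigenvalues, gives `Re tr (ρ U) ≥ cos T`.
Since `tr (ρ U)` is conjugate to `tr (√ρ U† √ρ)`, it is bounded in modulus by the trace norm of
`√ρ U† √ρ`, which is the fidelity of `ρ` and `U ρ U†`.

As `sInf ∅ = 0`, the bound on the infimum also requires that some duration is attained: equal
spectra provide a unitary `W = exp (-i H)` with `σ = W ρ W†`, and the constant Hamiltonian
`H / ‖H‖` implements it in time `‖H‖`.
-/

namespace QuantumCharging

open MeasureTheory Set Filter Topology Matrix
open scoped NNReal ComplexOrder

namespace IsDensityMatrix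

variable {n : Type*} [Fintype n] {ρ : Matrix n n ℂ}

theorem isHermitian (hρ : IsDensityMatrix ρ) : ρ.IsHermitian :=
  hρ.posSemidef.isHermitian

theorem nonempty (hρ : IsDensityMatrix ρ) : Nonempty n :=
  not_isEmpty_iff.1 fun _ => by simpa [Matrix.trace] using hρ.trace_eq_one

end IsDensityMatrix

section IntegralSolution

theorem lipschitzOnWith_mul_of_norm_le {X R : Type*} [PseudoMetricSpace X]
    [NormedRing R] {f g : X → R} {s : Set X} {Kf Kg Cf Cg : ℝ≥0}
    (hf : LipschitzOnWith Kf f s) (hg : LipschitzOnWith Kg g s)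
    (hfC : ∀ x ∈ s, ‖f x‖ ≤ Cf) (hgC : ∀ x ∈ s, ‖g x‖ ≤ Cg) :
    LipschitzOnWith (Cf * Kg + Kf * Cg) (fun x => f x * g x) s := by
  refine LipschitzOnWith.of_dist_le_mul fun x hx y hy => ?_
  have hsplit : f x * g x - f y * g y = f x * (g x - g y) + (f x - f y) * g y := by noncomm_ring
  calc dist (f x * g x) (f y * g y) = ‖f x * (g x - g y) + (f x - f y) * g y‖ := by
        rw [dist_eq_norm, hsplit]
    _ ≤ ‖f x * (g x - g y)‖ + ‖(f x - f y) * g y‖ := norm_add_le _ _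
    _ ≤ ‖f x‖ * dist (g x) (g y) + dist (f x) (f y) * ‖g y‖ := by
        simpa only [dist_eq_norm] using add_le_add (norm_mul_le _ _) (norm_mul_le _ _)
    _ ≤ Cf * (Kg * dist x y) + Kf * dist x y * Cg := by
        gcongr
        exacts [hfC x hx, hg.dist_le_mul x hx y hy, hf.dist_le_mul x hx y hy, hgC y hy]
    _ = (Cf * Kg + Kf * Cg : ℝ≥0) * dist x y := by push_cast; ring

variable {A : Type*} [NormedRing A] [NormedAlgebra ℝ A] {G U : ℝ → A} {a b s t : ℝ}

/-- `U` is a Carathéodory solution on `[a, b]` of the linear equation `U' = G U` in a Banach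
algebra. The equation is imposed in integral form so that `G` need not be continuous. -/
structure IsIntegralSolution (G U : ℝ → A) (a b : ℝ) : Prop where
  continuousOn : ContinuousOn U (Icc a b)
  eq_add_integral : ∀ t ∈ Icc a b, U t = U a + ∫ s in a..t, G s * U s

namespace IsIntegralSolution

theorem intervalIntegrable_mul (hU : IsIntegralSolution G U a b) (hG : IntegrableOn G (Icc a b))
    (hs : s ∈ Icc a b) (ht : t ∈ Icc a b) :
    IntervalIntegrable (fun r => G r * U r) volume s t := by
  have hst : uIcc s t ⊆ Icc a b := ordConnected_Icc.uIcc_subset hs ht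
  exact (hG.mono_set hst).intervalIntegrable.mul_continuousOn (hU.continuousOn.mono hst)

theorem sub_eq_integral (hU : IsIntegralSolution G U a b) (hG : IntegrableOn G (Icc a b))
    (hs : s ∈ Icc a b) (ht : t ∈ Icc a b) : U t - U s = ∫ r in s..t, G r * U r := by
  have ha : a ∈ Icc a b := left_mem_Icc.2 (hs.1.trans hs.2)
  rw [hU.eq_add_integral t ht, hU.eq_add_integral s hs, add_sub_add_left_eq_sub,
    intervalIntegral.integral_interval_sub_left (hU.intervalIntegrable_mul hG ha ht)
      (hU.intervalIntegrable_mul hG ha hs)]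

theorem lipschitzOnWith (hU : IsIntegralSolution G U a b) (hG : IntegrableOn G (Icc a b))
    {K : ℝ≥0} (hK : ∀ t ∈ Icc a b, ‖G t * U t‖ ≤ K) : LipschitzOnWith K U (Icc a b) := by
  refine LipschitzOnWith.of_dist_le_mul fun t ht s hs => ?_
  rw [dist_eq_norm, hU.sub_eq_integral hG hs ht, Real.dist_eq]
  refine intervalIntegral.norm_integral_le_of_norm_le_const fun r hr => ?_
  exact hK r (ordConnected_Icc.uIcc_subset hs ht (uIoc_subset_uIcc hr))

theorem ae_hasDerivAt [CompleteSpace A] (hU : IsIntegralSolution G U a b)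
    (hG : IntegrableOn G (Icc a b)) :
    ∀ᵐ t, t ∈ Icc a b → HasDerivAt U (G t * U t) t := by
  rcases lt_or_ge b a with hba | hab
  · simp [Icc_eq_empty_of_lt hba]
  have hint := hU.intervalIntegrable_mul hG (left_mem_Icc.2 hab) (right_mem_Icc.2 hab)
  filter_upwards [hint.ae_hasDerivAt_integral, Measure.ae_ne volume a, Measure.ae_ne volume b]
    with t hderiv hta htb ht
  rw [uIcc_of_le hab] at hderiv
  have ht' : t ∈ Ioo a b := ⟨ht.1.lt_of_ne' hta, ht.2.lt_of_ne htb⟩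
  refine ((hderiv ht a (left_mem_Icc.2 hab)).const_add (U a)).congr_of_eventuallyEq ?_
  filter_upwards [Ioo_mem_nhds ht'.1 ht'.2] with r hr
    using hU.eq_add_integral r (Ioo_subset_Icc_self hr)

theorem star_mul_self_eq [CompleteSpace A] [StarRing A] [NormedStarGroup A] [StarModule ℝ A]
    (hU : IsIntegralSolution G U a b) (hG : IntegrableOn G (Icc a b)) {K : ℝ≥0}
    (hK : ∀ t ∈ Icc a b, ‖G t‖ ≤ K) (hskew : ∀ t ∈ Icc a b, star (G t) = -G t)
    (ht : t ∈ Icc a b) : star (U t) * U t = star (U a) * U a := by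
  have hab : a ≤ b := ht.1.trans ht.2
  obtain ⟨C, hC⟩ : ∃ C : ℝ≥0, ∀ t ∈ Icc a b, ‖U t‖ ≤ C := by
    obtain ⟨C, hC⟩ := isCompact_Icc.exists_bound_of_continuousOn hU.continuousOn
    exact ⟨C.toNNReal, fun t ht => (hC t ht).trans (Real.le_coe_toNNReal C)⟩
  have hL : LipschitzOnWith (K * C) U (Icc a b) := hU.lipschitzOnWith hG fun t ht => by
    rw [NNReal.coe_mul]
    exact norm_mul_le_of_le (hK t ht) (hC t ht)
  have hLstar : LipschitzOnWith (K * C) (fun t => star (U t)) (Icc a b) :=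
    fun t ht s hs => (star_isometry.edist_eq (U t) (U s)).trans_le (hL ht hs)
  have hLmul := lipschitzOnWith_mul_of_norm_le hLstar hL
    (fun t ht => (norm_star (U t)).trans_le (hC t ht)) hC
  rw [← uIcc_of_le hab] at hLmul
  have hderiv : ∀ᵐ t, t ∈ uIcc a b → HasDerivAt (fun t => star (U t) * U t) 0 t := by
    rw [uIcc_of_le hab]
    filter_upwards [hU.ae_hasDerivAt hG] with t h ht
    refine ((h ht).star.mul (h ht)).congr_deriv ?_
    simp [hskew t ht, mul_assoc]
  obtain ⟨c, hc⟩ := hLmul.absolutelyContinuousOnInterval.const_of_ae_hasDerivAt_zero hderiv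
  rw [uIcc_of_le hab] at hc
  exact (hc t ht).trans (hc a (left_mem_Icc.2 hab)).symm

end IsIntegralSolution

end IntegralSolution

section Angle

open InnerProductGeometry
open scoped Real

section RealInnerProductSpace

variable {E : Type*} [NormedAddCommGroup E] [InnerProductSpace ℝ E]

theorem angle_eq_two_mul_arcsin_of_norm_eq_one {x y : E} (hx : ‖x‖ = 1) (hy : ‖y‖ = 1) :
    angle x y = 2 * Real.arcsin (‖x - y‖ / 2) := by
  have h0 := angle_nonneg x y
  have hπ := angle_le_pi x y
  have hsin : 0 ≤ Real.sin (angle x y / 2) :=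
    Real.sin_nonneg_of_nonneg_of_le_pi (by linarith) (by linarith)
  have hnorm : ‖x - y‖ = 2 * Real.sin (angle x y / 2) := by
    rw [← sq_eq_sq₀ (norm_nonneg _) (by positivity), norm_sub_sq_real,
      inner_eq_cos_angle_of_norm_eq_one hx hy, hx, hy, mul_pow, Real.sin_sq_eq_half_sub]
    ring_nf
  rw [hnorm, mul_div_cancel_left₀ _ two_ne_zero,
    Real.arcsin_sin (by linarith) (by linarith)]
  ring

theorem tendsto_two_mul_arcsin_slope (K x : ℝ) :
    Tendsto (fun z => 2 * Real.arcsin (K * (z - x) / 2) / (z - x)) (𝓝[>] x) (𝓝 K) := by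
  have hinner : HasDerivAt (fun z : ℝ => K * (z - x) / 2) (K / 2) x := by
    simpa using (((hasDerivAt_id x).sub_const x).const_mul K).div_const 2
  have harcsin : HasDerivAt Real.arcsin 1 (K * (x - x) / 2) := by
    simpa using Real.hasDerivAt_arcsin (x := 0) (by norm_num) (by norm_num)
  have h : HasDerivAt (fun z => 2 * Real.arcsin (K * (z - x) / 2)) K x :=
    ((harcsin.comp (h := fun z => K * (z - x) / 2) x hinner).const_mul 2).congr_deriv (by ring)
  simpa [slope_fun_def_field] using h.tendsto_slope.mono_left (nhdsGT_le_nhdsNE x)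

theorem slope_angle_le_of_lipschitzOnWith {ψ : ℝ → E} {K : ℝ≥0} {s : Set ℝ}
    (hnorm : ∀ t ∈ s, ‖ψ t‖ = 1) (hψ : LipschitzOnWith K ψ s) (x : E) {t z : ℝ} (ht : t ∈ s)
    (hz : z ∈ s) (htz : t < z) :
    slope (fun r => angle x (ψ r)) t z ≤ 2 * Real.arcsin (K * (z - t) / 2) / (z - t) := by
  have hdist : ‖ψ t - ψ z‖ ≤ K * (z - t) := by
    simpa [dist_eq_norm, abs_of_neg (sub_neg.2 htz)] using hψ.dist_le_mul t ht z hz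
  rw [slope_def_field]
  refine div_le_div_of_nonneg_right ?_ (sub_pos.2 htz).le
  calc angle x (ψ z) - angle x (ψ t) ≤ angle (ψ t) (ψ z) :=
        sub_le_iff_le_add'.2 (angle_le_angle_add_angle _ _ _)
    _ = 2 * Real.arcsin (‖ψ t - ψ z‖ / 2) :=
        angle_eq_two_mul_arcsin_of_norm_eq_one (hnorm t ht) (hnorm z hz)
    _ ≤ 2 * Real.arcsin (K * (z - t) / 2) :=
        mul_le_mul_of_nonneg_left (Real.monotone_arcsin (by linarith)) zero_le_two

theorem angle_le_mul_of_lipschitzOnWith {ψ : ℝ → E} {K : ℝ≥0} {a b : ℝ} (hab : a ≤ b)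
    (hnorm : ∀ t ∈ Icc a b, ‖ψ t‖ = 1) (hψ : LipschitzOnWith K ψ (Icc a b)) :
    angle (ψ a) (ψ b) ≤ K * (b - a) := by
  have hne : ∀ t ∈ Icc a b, ψ t ≠ 0 := fun t ht => ne_zero_of_norm_ne_zero (by simp [hnorm t ht])
  have ha : a ∈ Icc a b := left_mem_Icc.2 hab
  have hcont : ContinuousOn (fun t => angle (ψ a) (ψ t)) (Icc a b) := fun t ht =>
    (continuousAt_angle (hne a ha) (hne t ht)).comp_continuousWithinAt (f := fun t => (ψ a, ψ t))
      (continuousWithinAt_const.prodMk (hψ.continuousOn t ht))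
  have hbound : ∀ t, HasDerivAt (fun t => K * (t - a)) (K : ℝ) t := fun t => by
    simpa using ((hasDerivAt_id t).sub_const a).const_mul (K : ℝ)
  refine image_le_of_liminf_slope_right_le_deriv_boundary (f := fun t => angle (ψ a) (ψ t))
    (B := fun t => K * (t - a)) (B' := fun _ => K) hcont ?_
    (fun t _ => (hbound t).continuousAt.continuousWithinAt)
    (fun t _ => (hbound t).hasDerivWithinAt) (fun t ht r hr => ?_) (right_mem_Icc.2 hab)
  · simp [angle_self (hne a ha)]
  · refine Eventually.frequently ?_
    filter_upwards [(tendsto_two_mul_arcsin_slope K t).eventually_lt_const hr,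
      Ioo_mem_nhdsGT ht.2] with z hzr hz
    exact (slope_angle_le_of_lipschitzOnWith hnorm hψ (ψ a) (Ico_subset_Icc_self ht)
      ⟨ht.1.trans hz.1.le, hz.2.le⟩ hz.1).trans_lt hzr

end RealInnerProductSpace

theorem cos_le_re_inner_of_lipschitzOnWith {𝕜 E : Type*} [RCLike 𝕜] [NormedAddCommGroup E]
    [InnerProductSpace 𝕜 E] {ψ : ℝ → E} {K : ℝ≥0} {a b : ℝ} (hab : a ≤ b)
    (hπ : K * (b - a) ≤ π) (hnorm : ∀ t ∈ Icc a b, ‖ψ t‖ = 1)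
    (hψ : LipschitzOnWith K ψ (Icc a b)) :
    Real.cos (K * (b - a)) ≤ RCLike.re (inner 𝕜 (ψ a) (ψ b)) := by
  let := InnerProductSpace.rclikeToReal 𝕜 E
  rw [← real_inner_eq_re_inner, inner_eq_cos_angle_of_norm_eq_one
    (hnorm a (left_mem_Icc.2 hab)) (hnorm b (right_mem_Icc.2 hab))]
  exact Real.cos_le_cos_of_nonneg_of_le_pi (angle_nonneg _ _) hπ
    (angle_le_mul_of_lipschitzOnWith hab hnorm hψ)

end Angle

section Trace

open scoped MatrixOrder

variable {n : Type*} [Fintype n] [DecidableEq n]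

section RCLike

variable {𝕜 : Type*} [RCLike 𝕜]

theorem trace_eq_sum_inner_toEuclideanCLM (M : Matrix n n 𝕜)
    (b : OrthonormalBasis n 𝕜 (EuclideanSpace 𝕜 n)) :
    M.trace = ∑ i, inner 𝕜 (b i) (toEuclideanCLM (𝕜 := 𝕜) M (b i)) :=
  (trace_toLin_eq M (EuclideanSpace.basisFun n 𝕜).toBasis).symm.trans
    (LinearMap.trace_eq_sum_inner _ b)

theorem toEuclideanCLM_eigenvectorBasis {M : Matrix n n 𝕜} (hM : M.IsHermitian) (i : n) :
    toEuclideanCLM (𝕜 := 𝕜) M (hM.eigenvectorBasis i) =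
      (hM.eigenvalues i : 𝕜) • hM.eigenvectorBasis i := by
  rw [← RCLike.real_smul_eq_coe_smul]
  exact congrArg (WithLp.toLp 2) (hM.mulVec_eigenvectorBasis i)

theorem mul_re_trace_le_re_trace_mul {M U : Matrix n n 𝕜} (hM : M.PosSemidef) {c : ℝ}
    (hU : ∀ v, ‖v‖ = 1 → c ≤ RCLike.re (inner 𝕜 v (toEuclideanCLM (𝕜 := 𝕜) U v))) :
    c * RCLike.re M.trace ≤ RCLike.re (M * U).trace := by
  have hH := hM.isHermitian
  rw [trace_mul_comm, trace_eq_sum_inner_toEuclideanCLM (U * M) hH.eigenvectorBasis,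
    hH.trace_eq_sum_eigenvalues, map_sum, map_sum, Finset.mul_sum]
  refine Finset.sum_le_sum fun i _ => ?_
  have hi := hU _ (hH.eigenvectorBasis.orthonormal.norm_eq_one i)
  rw [map_mul, mul_apply_eq_comp, toEuclideanCLM_eigenvectorBasis, map_smul,
    inner_smul_right, RCLike.re_ofReal_mul, RCLike.ofReal_re, mul_comm c]
  exact mul_le_mul_of_nonneg_left hi (hM.eigenvalues_nonneg i)

theorem norm_toEuclideanCLM_eq_of_star_mul_self_eq {M N : Matrix n n 𝕜}
    (h : star M * M = star N * N) (x : EuclideanSpace 𝕜 n) :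
    ‖toEuclideanCLM (𝕜 := 𝕜) M x‖ = ‖toEuclideanCLM (𝕜 := 𝕜) N x‖ := by
  have hsq (P : Matrix n n 𝕜) : ‖toEuclideanCLM (𝕜 := 𝕜) P x‖ ^ 2 =
      RCLike.re (inner 𝕜 (toEuclideanCLM (𝕜 := 𝕜) (star P * P) x) x) := by
    rw [map_mul, map_star]
    exact ContinuousLinearMap.apply_norm_sq_eq_inner_adjoint_left _ x
  rw [← sq_eq_sq₀ (norm_nonneg _) (norm_nonneg _), hsq, hsq, h]

theorem norm_trace_le_re_trace_abs (N : Matrix n n 𝕜) :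
    ‖N.trace‖ ≤ RCLike.re (CFC.abs N).trace := by
  have hpos : (CFC.abs N).PosSemidef := nonneg_iff_posSemidef.1 (CFC.abs_nonneg N)
  have hH := hpos.isHermitian
  have hnorm (x : EuclideanSpace 𝕜 n) :
      ‖toEuclideanCLM (𝕜 := 𝕜) N x‖ = ‖toEuclideanCLM (𝕜 := 𝕜) (CFC.abs N) x‖ :=
    norm_toEuclideanCLM_eq_of_star_mul_self_eq
      (by rw [(CFC.abs_nonneg N).isSelfAdjoint.star_eq, CFC.abs_mul_abs]) x
  rw [trace_eq_sum_inner_toEuclideanCLM N hH.eigenvectorBasis, hH.trace_eq_sum_eigenvalues,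
    map_sum]
  refine norm_sum_le_of_le _ fun i _ => ?_
  have hi := hH.eigenvectorBasis.orthonormal.norm_eq_one i
  calc ‖inner 𝕜 (hH.eigenvectorBasis i) (toEuclideanCLM (𝕜 := 𝕜) N (hH.eigenvectorBasis i))‖
      ≤ ‖toEuclideanCLM (𝕜 := 𝕜) N (hH.eigenvectorBasis i)‖ := by
        simpa only [hi, one_mul] using norm_inner_le_norm (𝕜 := 𝕜) (hH.eigenvectorBasis i) _
    _ = ‖(hH.eigenvalues i : 𝕜) • hH.eigenvectorBasis i‖ := by
        rw [hnorm, toEuclideanCLM_eigenvectorBasis]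
    _ = RCLike.re (hH.eigenvalues i : 𝕜) := by
        rw [norm_smul, hi, mul_one, RCLike.ofReal_re,
          RCLike.norm_of_nonneg (hpos.eigenvalues_nonneg i)]

end RCLike

theorem fidelity_nonneg (ρ σ : Matrix n n ℂ) : 0 ≤ fidelity ρ σ :=
  (Complex.nonneg_iff.1 (nonneg_iff_posSemidef.1 (CFC.sqrt_nonneg _)).trace_nonneg).1

theorem fidelity_conj_eq_re_trace_abs {ρ : Matrix n n ℂ} (hρ : ρ.PosSemidef) (U : Matrix n n ℂ) :
    fidelity ρ (U * ρ * Uᴴ) = (CFC.abs (CFC.sqrt ρ * Uᴴ * CFC.sqrt ρ)).trace.re := by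
  have hstar : (CFC.sqrt ρ)ᴴ = CFC.sqrt ρ := (CFC.sqrt_nonneg ρ).isSelfAdjoint
  have hsq : CFC.sqrt ρ * CFC.sqrt ρ = ρ := CFC.sqrt_mul_sqrt_self ρ hρ.nonneg
  have habs : CFC.sqrt ρ * (U * ρ * Uᴴ) * CFC.sqrt ρ =
      star (CFC.sqrt ρ * Uᴴ * CFC.sqrt ρ) * (CFC.sqrt ρ * Uᴴ * CFC.sqrt ρ) := by
    nth_rw 2 [← hsq]
    simp only [star_eq_conjTranspose, conjTranspose_mul, conjTranspose_conjTranspose, hstar,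
      Matrix.mul_assoc]
  rw [fidelity, CFC.abs, habs]

theorem re_trace_mul_le_fidelity_conj {ρ : Matrix n n ℂ} (hρ : ρ.PosSemidef)
    (U : Matrix n n ℂ) : (ρ * U).trace.re ≤ fidelity ρ (U * ρ * Uᴴ) := by
  have htrace : (CFC.sqrt ρ * Uᴴ * CFC.sqrt ρ).trace = star (ρ * U).trace := by
    rw [← trace_conjTranspose, conjTranspose_mul, hρ.isHermitian.eq, trace_mul_comm,
      ← Matrix.mul_assoc, CFC.sqrt_mul_sqrt_self ρ hρ.nonneg, trace_mul_comm]
  calc (ρ * U).trace.re ≤ ‖(ρ * U).trace‖ := Complex.re_le_norm _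
    _ = ‖(CFC.sqrt ρ * Uᴴ * CFC.sqrt ρ).trace‖ := by rw [htrace, norm_star]
    _ ≤ fidelity ρ (U * ρ * Uᴴ) := by
        rw [fidelity_conj_eq_re_trace_abs hρ]
        exact norm_trace_le_re_trace_abs _

end Trace

section LowerBound

open scoped Matrix.Norms.L2Operator

variable {n : Type*} [Fintype n] [DecidableEq n] {T t : ℝ} {V U : ℝ → Matrix n n ℂ}

theorem IsChargingHamiltonian.integrableOn (hV : IsChargingHamiltonian T V) :
    IntegrableOn V (Icc 0 T) :=
  Integrable.of_bound hV.aestronglyMeasurable 1 <|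
    (ae_restrict_iff' measurableSet_Icc).2 (.of_forall fun t ht => (hV.norm_eq_one t ht).le)

namespace IsPropagator

theorem apply_zero (hU : IsPropagator T V U) (hT : 0 ≤ T) : U 0 = 1 := by
  simpa using hU.eq_integral 0 (left_mem_Icc.2 hT)

theorem isIntegralSolution (hU : IsPropagator T V U) :
    IsIntegralSolution (fun t => -(Complex.I • V t)) U 0 T where
  continuousOn := hU.continuousOn
  eq_add_integral t ht := by
    rw [hU.apply_zero (ht.1.trans ht.2), hU.eq_integral t ht]
    simp only [neg_mul, smul_mul_assoc, intervalIntegral.integral_neg,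
      intervalIntegral.integral_smul, sub_eq_add_neg]

theorem mem_unitary (hU : IsPropagator T V U) (hV : IsChargingHamiltonian T V)
    (ht : t ∈ Icc 0 T) : U t ∈ unitary (Matrix n n ℂ) := by
  have hstar : star (U t) * U t = star (U 0) * U 0 := by
    refine hU.isIntegralSolution.star_mul_self_eq (hV.integrableOn.smul Complex.I).neg (K := 1)
      (fun s hs => ?_) (fun s hs => ?_) ht
    · simp [norm_smul, hV.norm_eq_one s hs]
    · have hself : star (V s) = V s := hV.isHermitian s hs
      simp [hself]
  rw [hU.apply_zero (ht.1.trans ht.2), star_one, one_mul] at hstar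
  exact mem_unitaryGroup_iff'.2 hstar

theorem lipschitzOnWith (hU : IsPropagator T V U) (hV : IsChargingHamiltonian T V) :
    LipschitzOnWith 1 U (Icc 0 T) := by
  refine hU.isIntegralSolution.lipschitzOnWith (hV.integrableOn.smul Complex.I).neg fun t ht => ?_
  rw [CStarRing.norm_mul_mem_unitary _ (hU.mem_unitary hV ht)]
  simp [norm_smul, hV.norm_eq_one t ht]

theorem cos_le_re_inner (hU : IsPropagator T V U) (hV : IsChargingHamiltonian T V)
    (hT : 0 ≤ T) (hπ : T ≤ Real.pi) {v : EuclideanSpace ℂ n} (hv : ‖v‖ = 1) :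
    Real.cos T ≤ (inner ℂ v (toEuclideanCLM (𝕜 := ℂ) (U T) v)).re := by
  have hnorm : ∀ t ∈ Icc 0 T, ‖toEuclideanCLM (𝕜 := ℂ) (U t) v‖ = 1 := fun t ht => by
    rw [ContinuousLinearMap.norm_map_of_mem_unitary
      (Unitary.map_mem (toEuclideanCLM (𝕜 := ℂ)) (hU.mem_unitary hV ht)), hv]
  have hlip : LipschitzOnWith 1 (fun t => toEuclideanCLM (𝕜 := ℂ) (U t) v) (Icc 0 T) := by
    refine LipschitzOnWith.of_dist_le_mul fun t ht s hs => ?_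
    calc dist (toEuclideanCLM (𝕜 := ℂ) (U t) v) (toEuclideanCLM (𝕜 := ℂ) (U s) v)
        = ‖toEuclideanCLM (𝕜 := ℂ) (U t - U s) v‖ := by
          rw [dist_eq_norm, map_sub, _root_.sub_apply]
      _ ≤ dist (U t) (U s) * ‖v‖ := by
          rw [dist_eq_norm, cstar_norm_def]
          exact ContinuousLinearMap.le_opNorm _ _
      _ ≤ (1 : ℝ≥0) * dist t s := by
          rw [hv, mul_one]
          exact (hU.lipschitzOnWith hV).dist_le_mul t ht s hs
  simpa [hU.apply_zero hT] using
    cos_le_re_inner_of_lipschitzOnWith (𝕜 := ℂ) hT (by simpa using hπ) hnorm hlip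

end IsPropagator

theorem buresAngle_le_of_mem_chargingTimes {ρ σ : Matrix n n ℂ} (hρ : IsDensityMatrix ρ)
    (hT : T ∈ chargingTimes ρ σ) : buresAngle ρ σ ≤ T := by
  obtain ⟨hT0, V, U, hV, hU, rfl⟩ := hT
  rcases le_total T (Real.pi / 2) with hsmall | hlarge
  · have hπ : T ≤ Real.pi := hsmall.trans (half_le_self Real.pi_nonneg)
    have hcos : Real.cos T ≤ (ρ * U T).trace.re := by
      simpa [hρ.trace_eq_one] using
        mul_re_trace_le_re_trace_mul hρ.posSemidef fun v hv => hU.cos_le_re_inner hV hT0 hπ hv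
    calc buresAngle ρ (U T * ρ * (U T)ᴴ) ≤ Real.arccos (Real.cos T) :=
          Real.arccos_le_arccos (hcos.trans (re_trace_mul_le_fidelity_conj hρ.posSemidef (U T)))
      _ = T := Real.arccos_cos hT0 hπ
  · exact (Real.arccos_le_pi_div_two.2 (fidelity_nonneg _ _)).trans hlarge

end LowerBound

section Attainability

theorem exists_unitary_conj_of_roots_charpoly_eq {𝕜 n : Type*} [RCLike 𝕜] [Fintype n]
    [DecidableEq n] {A B : Matrix n n 𝕜} (hA : A.IsHermitian) (hB : B.IsHermitian)
    (h : A.charpoly.roots = B.charpoly.roots) :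
    ∃ W : unitaryGroup n 𝕜, B = W * A * (W : Matrix n n 𝕜)ᴴ := by
  have hcharpoly : A.charpoly = B.charpoly := by
    rw [hA.splits_charpoly.eq_prod_roots_of_monic A.charpoly_monic,
      hB.splits_charpoly.eq_prod_roots_of_monic B.charpoly_monic, h]
  have heigenvalues := (hA.eigenvalues_eq_eigenvalues_iff hB).2 hcharpoly
  refine ⟨hB.eigenvectorUnitary * star hA.eigenvectorUnitary, ?_⟩
  calc B = Unitary.conjStarAlgAut 𝕜 _ hB.eigenvectorUnitary
          (diagonal (RCLike.ofReal ∘ hA.eigenvalues)) := by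
        rw [heigenvalues]; exact hB.spectral_theorem
    _ = Unitary.conjStarAlgAut 𝕜 _ (hB.eigenvectorUnitary * star hA.eigenvectorUnitary) A := by
        rw [← hA.conjStarAlgAut_star_eigenvectorUnitary, Unitary.conjStarAlgAut_mul_apply]
    _ = _ := Unitary.conjStarAlgAut_apply _ _

theorem expUnitary_argSelfAdjoint_of_continuousOn {A : Type*} [CStarAlgebra A] {u : unitary A}
    (hu : ContinuousOn Complex.arg (spectrum ℂ (u : A))) :
    selfAdjoint.expUnitary (Unitary.argSelfAdjoint u) = u := by
  have hcont : ContinuousOn (fun z => (Complex.arg z : ℂ)) (spectrum ℂ (u : A)) :=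
    Complex.continuous_ofReal.comp_continuousOn hu
  ext
  rw [selfAdjoint.expUnitary_coe, Unitary.argSelfAdjoint_coe,
    ← CFC.exp_eq_normedSpace_exp (𝕜 := ℂ), ← cfc_comp_smul .., ← cfc_comp' ..]
  conv_rhs => rw [← cfc_id' ℂ (u : A)]
  refine cfc_congr fun z hz => ?_
  have hz1 : ‖z‖ = 1 := spectrum.norm_eq_one_of_unitary u.2 hz
  simpa [hz1, mul_comm, Complex.exp_eq_exp_ℂ] using Complex.norm_mul_exp_arg_mul_I z

theorem exists_isSelfAdjoint_norm_eq_one_eq_norm_smul {A : Type*} [NormedRing A] [StarRing A]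
    [CStarRing A] [Nontrivial A] [NormedSpace ℝ A] [StarModule ℝ A] {a : A}
    (ha : IsSelfAdjoint a) : ∃ b : A, IsSelfAdjoint b ∧ ‖b‖ = 1 ∧ ‖a‖ • b = a := by
  rcases eq_or_ne a 0 with rfl | ha0
  · exact ⟨1, .one A, CStarRing.norm_one, by simp⟩
  · exact ⟨NormedSpace.normalize a, (IsSelfAdjoint.all _).smul ha,
      NormedSpace.norm_normalize ha0, NormedSpace.norm_smul_normalize a⟩

open scoped Matrix.Norms.L2Operator

variable {n : Type*} [Fintype n] [DecidableEq n]

theorem isPropagator_exp (T : ℝ) (K : Matrix n n ℂ) :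
    IsPropagator T (fun _ => K) (fun t => NormedSpace.exp (t • -(Complex.I • K))) := by
  have hderiv := hasDerivAt_exp_smul_const' (𝕂 := ℝ) (-(Complex.I • K))
  have hcont : Continuous fun t : ℝ => NormedSpace.exp (t • -(Complex.I • K)) :=
    continuous_iff_continuousAt.2 fun t => (hderiv t).continuousAt
  refine ⟨hcont.continuousOn, fun t _ => ?_⟩
  have hftc := intervalIntegral.integral_eq_sub_of_hasDerivAt (a := 0) (b := t)
    (fun s _ => hderiv s) ((continuous_const.mul hcont).intervalIntegrable _ _)
  simp only [neg_mul, smul_mul_assoc, intervalIntegral.integral_neg,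
    intervalIntegral.integral_smul, zero_smul, NormedSpace.exp_zero] at hftc
  rw [sub_eq_add_neg, hftc, add_sub_cancel]

theorem norm_mem_chargingTimes [Nonempty n] {H : Matrix n n ℂ} (hH : H.IsHermitian)
    (ρ : Matrix n n ℂ) :
    ‖H‖ ∈ chargingTimes ρ (NormedSpace.exp (-(Complex.I • H)) * ρ *
      (NormedSpace.exp (-(Complex.I • H)))ᴴ) := by
  obtain ⟨K, hK, hK1, hHK⟩ := exists_isSelfAdjoint_norm_eq_one_eq_norm_smul hH
  refine ⟨norm_nonneg H, _, _, ⟨aestronglyMeasurable_const, fun _ _ => hK, fun _ _ => hK1⟩,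
    isPropagator_exp _ K, ?_⟩
  rw [smul_neg, smul_comm, hHK]

theorem chargingTimes_nonempty [Nonempty n] {ρ σ : Matrix n n ℂ} (hρ : ρ.IsHermitian)
    (hσ : σ.IsHermitian) (h : SameSpectrum ρ σ) : (chargingTimes ρ σ).Nonempty := by
  obtain ⟨W, rfl⟩ := exists_unitary_conj_of_roots_charpoly_eq hρ hσ h
  set H := Unitary.argSelfAdjoint W
  have hexp : NormedSpace.exp (Complex.I • (H : Matrix n n ℂ)) = W :=
    congrArg Subtype.val (expUnitary_argSelfAdjoint_of_continuousOn
      ((finite_spectrum (W : Matrix n n ℂ)).continuousOn _))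
  have hmem := norm_mem_chargingTimes (H.2.neg : (-(H : Matrix n n ℂ)).IsHermitian) ρ
  rw [smul_neg, neg_neg, hexp] at hmem
  exact ⟨_, hmem⟩

end Attainability

end QuantumCharging

theorem theorem6 {n : Type*} [Fintype n] [DecidableEq n] (ρ σ : Matrix n n ℂ)
    (hρ : QuantumCharging.IsDensityMatrix ρ) (hσ : QuantumCharging.IsDensityMatrix σ)
    (hspec : QuantumCharging.SameSpectrum ρ σ) :
    QuantumCharging.buresAngle ρ σ ≤ QuantumCharging.chargingDistance ρ σ := by
  have := hρ.nonempty
  exact le_csInf (QuantumCharging.chargingTimes_nonempty hρ.isHermitian hσ.isHermitian hspec)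
    fun _ hT => QuantumCharging.buresAngle_le_of_mem_chargingTimes hρ hT
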